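/- Let $n\ge 2$, let $\mathbf Q=(q_{ij})$ be the generator matrix of an irreducible continuous-time Markov chain on $\{1,\dots,M\}$, and let $\lambda_s>0$, $\lambda\ge 0$. Consider the Markov jump process (fully connected, timeliness-based gossip network) whose state consists of the state $Q(t)\in\{1,\dots,M\}$ of a source and, for each node $i\in\{1,\dots,n\}$, of the stored content $S_i(t)\in\{1,\dots,M\}$ and the version age $X_i(t)\in\{0,1,2,\dots\}$, with the following independent transitions: - for $r\ne Q$, at rate $q_{Qr}$ the source jumps to $r$, and every $X_i$ increases by $1$; - for each node $j$, at rate $\lambda_s/n$ the source updates node $j$: $X_j:=0$, $S_j:=Q$; - for each ordered pair of nodes $i\neq j$, at rate $\lambda/(n-1)$ node $i$ sends its packet to node $j$, which accepts it if and only if it is fresher: $X_j:=\min\{X_i,X_j\}$, and $S_j:=S_i$ if $X_i<X_j$. For a nonempty set $A$ of nodes let $X_A(t)=\min_{j\in A}X_j(t)$. For $1\le k\le n-1$ and $m\in\{1,\dots,M\}$ put $$\alpha_k=\frac{k\lambda_s}{n},\qquad \beta_k=\frac{k(n-k)\lambda}{n-1},\qquad \nu_m=\sum_{r\ne m}q_{mr}.$$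 Then, for every $m\in\{1,\dots,M\}$ and every $1\le k\le n$, the limit $$g_k^{(m)}=\lim_{t\to\infty}\mathbb P\bigl(Q(t)=m,\ X_{A}(t)=0\bigr),\qquad |A|=k,$$ exists and depends neither on the choice of the $k$-element set $A$ nor on the initial state or initial distribution of the process. For every $\lambda\ge0$, every $m$ and every $1\le k\le n-1$, $$\bigl|g_k^{(m)}-g_{k+1}^{(m)}\bigr|\le\frac{\alpha_k+\nu_m}{\nu_m+\alpha_k+\beta_k}.$$ Moreover, with $n$, $\mathbf Q$ and $\lambda_s$ fixed, $$\lim_{\lambda\to\infty}\bigl(g_k^{(m)}-g_{k+1}^{(m)}\bigr)=0\qquad(1\le k\le n-1),$$ and $g_1^{(m)},\dots,g_n^{(m)}$ all converge, as $\lambda\to\infty$, to one and the same limit. -/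

import Mathlib

open Filter Topology MeasureTheory
open scoped NNReal BoundedContinuousFunction

noncomputable section

namespace GossipNetwork

/-- A generator matrix (transition rates off the diagonal, zero row sums) of an irreducible
continuous-time Markov chain on `M` states. -/
structure IsIrreducibleGenerator {M : ℕ} (q : Matrix (Fin M) (Fin M) ℝ) : Prop where
  nonneg : ∀ i j, i ≠ j → 0 ≤ q i j
  row_sum : ∀ i, ∑ j, q i j = 0
  irreducible : ∀ i j, Relation.ReflTransGen (fun a b => a ≠ b ∧ 0 < q a b) i j

/-- The state of the network: the current state `Q` of the source, and for every node the
content `S i` of its stored packet and its version age `X i` (the number of versions by which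
the stored packet lags behind the source). -/
structure State (n M : ℕ) where
  source : Fin M
  content : Fin n → Fin M
  age : Fin n → ℕ

instance (n M : ℕ) : TopologicalSpace (State n M) := ⊥
instance (n M : ℕ) : DiscreteTopology (State n M) := ⟨rfl⟩
instance (n M : ℕ) : MeasurableSpace (State n M) := ⊤

variable {n M : ℕ}

/-- The source jumps to `r` and thereby generates a new version: all ages grow by one. -/
def State.jump (z : State n M) (r : Fin M) : State n M where
  source := r
  content := z.content
  age := fun l => z.age l + 1

/-- The source sends its current state to node `j`. -/
def State.push (z : State n M) (j : Fin n) : State n M where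
  source := z.source
  content := Function.update z.content j z.source
  age := Function.update z.age j 0

/-- Node `i` sends its packet to node `j`, which keeps it if and only if it is fresher than
its own packet. -/
def State.gossip (z : State n M) (i j : Fin n) : State n M where
  source := z.source
  content := Function.update z.content j
    (if z.age i < z.age j then z.content i else z.content j)
  age := Function.update z.age j (min (z.age i) (z.age j))

/-- The version age of a nonempty set of nodes: the age of its freshest node. -/
def State.setAge (z : State n M) (A : Finset (Fin n)) (hA : A.Nonempty) : ℕ :=
  A.inf' hA z.age

/-- The generator of the network process as a formula: source jumps `i → r` at rate `q i r`,
source pushes to each node at rate `lamS / n`, and gossip from `i` to `j` at rate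
`lam / (n - 1)` for every ordered pair of distinct nodes. -/
def generatorFun (q : Matrix (Fin M) (Fin M) ℝ) (lamS lam : ℝ) (f : State n M → ℝ)
    (z : State n M) : ℝ :=
  (∑ r ∈ Finset.univ.erase z.source, q z.source r * (f (z.jump r) - f z))
  + (∑ j : Fin n, lamS / n * (f (z.push j) - f z))
  + ∑ j : Fin n, ∑ i ∈ Finset.univ.erase j, lam / ((n : ℝ) - 1) * (f (z.gossip i j) - f z)

theorem abs_generatorFun_le (q : Matrix (Fin M) (Fin M) ℝ) (lamS lam : ℝ)
    (f : State n M →ᵇ ℝ) (z : State n M) :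
    |generatorFun q lamS lam f z| ≤
      (((∑ i : Fin M, ∑ r : Fin M, |q i r|) * 2 + (∑ _j : Fin n, |lamS / n|) * 2)
        + (∑ _j : Fin n, ∑ _i : Fin n, |lam / ((n : ℝ) - 1)|) * 2) * ‖f‖ := by
  have key : ∀ (c : ℝ) (x y : State n M), |c * (f x - f y)| ≤ |c| * (2 * ‖f‖) := by
    intro c x y
    rw [abs_mul]
    refine mul_le_mul_of_nonneg_left ?_ (abs_nonneg c)
    have := f.dist_le_two_norm x y
    rwa [Real.dist_eq] at this
  have hf : 0 ≤ 2 * ‖f‖ := by positivity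
  have h1 : |∑ r ∈ Finset.univ.erase z.source, q z.source r * (f (z.jump r) - f z)| ≤
      (∑ i : Fin M, ∑ r : Fin M, |q i r|) * (2 * ‖f‖) := by
    refine (Finset.abs_sum_le_sum_abs _ _).trans ?_
    refine (Finset.sum_le_sum fun r _ => key _ _ _).trans ?_
    rw [← Finset.sum_mul]
    refine mul_le_mul_of_nonneg_right ?_ hf
    refine (Finset.sum_le_sum_of_subset_of_nonneg (Finset.subset_univ _)
      fun _ _ _ => abs_nonneg _).trans ?_
    exact Finset.single_le_sum (f := fun i => ∑ r : Fin M, |q i r|)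
      (fun i _ => Finset.sum_nonneg fun _ _ => abs_nonneg _) (Finset.mem_univ z.source)
  have h2 : |∑ j : Fin n, lamS / n * (f (z.push j) - f z)| ≤
      (∑ _j : Fin n, |lamS / n|) * (2 * ‖f‖) := by
    refine (Finset.abs_sum_le_sum_abs _ _).trans ?_
    refine (Finset.sum_le_sum fun r _ => key _ _ _).trans ?_
    rw [← Finset.sum_mul]
  have h3 : |∑ j : Fin n, ∑ i ∈ Finset.univ.erase j,
        lam / ((n : ℝ) - 1) * (f (z.gossip i j) - f z)| ≤
      (∑ _j : Fin n, ∑ _i : Fin n, |lam / ((n : ℝ) - 1)|) * (2 * ‖f‖) := by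
    refine (Finset.abs_sum_le_sum_abs _ _).trans ?_
    rw [Finset.sum_mul]
    refine Finset.sum_le_sum fun j _ => ?_
    refine (Finset.abs_sum_le_sum_abs _ _).trans ?_
    refine (Finset.sum_le_sum fun r _ => key _ _ _).trans ?_
    rw [← Finset.sum_mul]
    exact mul_le_mul_of_nonneg_right (Finset.sum_le_sum_of_subset_of_nonneg
      (Finset.subset_univ _) fun _ _ _ => abs_nonneg _) hf
  have := (abs_add_le _ _).trans (add_le_add ((abs_add_le _ _).trans (add_le_add h1 h2)) h3)
  unfold generatorFun
  linarith

/-- The generator of the network process, as a bounded operator on the bounded functions of the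
network state. -/
def generator (q : Matrix (Fin M) (Fin M) ℝ) (lamS lam : ℝ) :
    (State n M →ᵇ ℝ) →L[ℝ] (State n M →ᵇ ℝ) :=
  LinearMap.mkContinuous
    { toFun := fun f => BoundedContinuousFunction.ofNormedAddCommGroupDiscrete
        (generatorFun q lamS lam f) _ (abs_generatorFun_le q lamS lam f)
      map_add' := by
        intro f g
        ext z
        simp only [BoundedContinuousFunction.coe_ofNormedAddCommGroupDiscrete,
          BoundedContinuousFunction.coe_add, Pi.add_apply, generatorFun,
          add_sub_add_comm, mul_add, Finset.sum_add_distrib]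
        ring
      map_smul' := by
        intro c f
        ext z
        simp only [BoundedContinuousFunction.coe_ofNormedAddCommGroupDiscrete,
          BoundedContinuousFunction.coe_smul, generatorFun, smul_eq_mul,
          RingHom.id_apply, ← mul_sub, mul_left_comm _ c, ← Finset.mul_sum, ← mul_add] }
    (((∑ i : Fin M, ∑ r : Fin M, |q i r|) * 2 + (∑ _j : Fin n, |lamS / n|) * 2)
      + (∑ _j : Fin n, ∑ _i : Fin n, |lam / ((n : ℝ) - 1)|) * 2)
    (fun f => BoundedContinuousFunction.norm_ofNormedAddCommGroup_le _ (by positivity)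
      (abs_generatorFun_le q lamS lam f))

theorem generator_apply (q : Matrix (Fin M) (Fin M) ℝ) (lamS lam : ℝ) (f : State n M →ᵇ ℝ)
    (z : State n M) : generator q lamS lam f z = generatorFun q lamS lam f z := rfl

/-- The exponential (power series) of a bounded operator on a normed space. -/
def operatorExp {E : Type*} [NormedAddCommGroup E] [NormedSpace ℝ E] (T : E →L[ℝ] E) :
    E →L[ℝ] E :=
  NormedSpace.exp T

/-- The transition semigroup of the network process: `semigroup q lamS lam t f z` is the
expectation of `f (Z t)` for the process `Z` started in the state `z`. As all jump rates are
bounded, it is the exponential of the generator. -/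
def semigroup (q : Matrix (Fin M) (Fin M) ℝ) (lamS lam : ℝ) (t : ℝ≥0) :
    (State n M →ᵇ ℝ) →L[ℝ] (State n M →ᵇ ℝ) :=
  operatorExp ((t : ℝ) • generator q lamS lam)

/-- The transition probability: that the process started in `z` is in `B` at time `t`. -/
def transProb (q : Matrix (Fin M) (Fin M) ℝ) (lamS lam : ℝ) (t : ℝ≥0) (z : State n M)
    (B : Set (State n M)) : ℝ :=
  semigroup q lamS lam t (BoundedContinuousFunction.indicator B (isClopen_discrete B)) z

/-- `Z` is the network process on the probability space `(Ω, P)`, with an arbitrary initial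
distribution: a Markov process with respect to its natural filtration, with right-continuous
(piecewise constant) paths and with the transition semigroup above. -/
structure IsNetworkProcess (q : Matrix (Fin M) (Fin M) ℝ) (lamS lam : ℝ) {Ω : Type*}
    [MeasurableSpace Ω] (P : Measure Ω) (Z : ℝ≥0 → Ω → State n M) : Prop where
  measurable : ∀ t, Measurable (Z t)
  right_continuous : ∀ᵐ ω ∂P, ∀ t, ContinuousWithinAt (fun u => Z u ω) (Set.Ici t) t
  markov : ∀ (s t : ℝ≥0) (f : State n M →ᵇ ℝ),
    P[fun ω => f (Z (s + t) ω) | ⨆ u ∈ Set.Iic s, MeasurableSpace.comap (Z u) ⊤]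
      =ᵐ[P] fun ω => semigroup q lamS lam t f (Z s ω)

/-- The event that the source is in state `m` and the set `A` is fresh, `Q = m` and
`X_A = 0`. -/
def freshEvent (m : Fin M) (A : Finset (Fin n)) (hA : A.Nonempty) : Set (State n M) :=
  {z | z.source = m ∧ z.setAge A hA = 0}

/-- `α_k`, the total rate of source pushes into a set of `k` nodes. -/
def pushRate (n : ℕ) (lamS : ℝ) (k : ℕ) : ℝ := k * lamS / n

/-- `β_k`, the total rate of gossip from outside into a set of `k` nodes. -/
def gossipRate (n : ℕ) (lam : ℝ) (k : ℕ) : ℝ := k * ((n : ℝ) - k) * lam / ((n : ℝ) - 1)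

/-- `ν_m`, the rate at which the source leaves the state `m`. -/
def exitRate (q : Matrix (Fin M) (Fin M) ℝ) (m : Fin M) : ℝ :=
  ∑ r ∈ Finset.univ.erase m, q m r

end GossipNetwork

end

namespace GossipNetwork

/-! ### Exponentials of bounded operators -/

section Exponential

variable {E F : Type*} [NormedAddCommGroup E] [NormedSpace ℝ E] [CompleteSpace E]
  [NormedAddCommGroup F] [NormedSpace ℝ F] [CompleteSpace F]

/-! The backward equation closes on the indicators of fresh events (`generator_freshFun`). A source
jump destroys freshness, a push into `A` leaves only the condition on the source, and gossip from
`i` into `A` makes `A` as fresh as `A ∪ {i}` was. With `k = |A|`, the indicator therefore decays at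
rate `ν_m + α_k + β_k` and is driven by the indicator of `Q = m` and by the fresh events of the sets
with one more node. Contents play no role.

The source evolves on its own and reaches equilibrium by a Doeblin contraction
(`exists_tendsto_exp_sourceGenerator`). Induction from `k = n` downwards, using that a stable linear
equation with convergent forcing converges, then gives `g_k = (α_k p + β_k g_{k+1}) / (ν_m + α_k +
β_k)` with `p` the equilibrium probability of `m` (`tendsto_exp_generator_freshFun`). Convergence is
in sup norm, hence uniform in the initial state, which covers every initial distribution.

In `g_k - g_{k+1}` the rate `β_k` cancels from the numerator and stays in the denominator. This
gives the bound and, as `λ → ∞`, the vanishing differences. Since `β_n = 0`, `g_n` does not depend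
on `λ` and is the common limit. -/

theorem hasSum_exp_apply (T : E →L[ℝ] E) (v : E) :
    HasSum (fun k : ℕ => ((k.factorial : ℝ)⁻¹) • (T ^ k) v) (operatorExp T v) :=
  (NormedSpace.exp_series_hasSum_exp' (𝕂 := ℝ) T).mapL (ContinuousLinearMap.apply ℝ E v)

theorem exp_intertwine {T : E →L[ℝ] E} {S : F →L[ℝ] F} {Φ : F →L[ℝ] E}
    (h : ∀ v, T (Φ v) = Φ (S v)) (v : F) :
    operatorExp T (Φ v) = Φ (operatorExp S v) := by
  have hk : ∀ (k : ℕ) (w : F), (T ^ k) (Φ w) = Φ ((S ^ k) w) := by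
    intro k
    induction k with
    | zero => intro w; simp
    | succ k ih => intro w; rw [pow_succ, pow_succ]; simp [h, ih]
  refine (hasSum_exp_apply T (Φ v)).unique ?_
  convert (hasSum_exp_apply S v).mapL Φ using 2 with k
  rw [hk, map_smul]

theorem exp_apply_of_apply_eq_zero {T : E →L[ℝ] E} {v : E} (h : T v = 0) :
    operatorExp T v = v := by
  refine (hasSum_exp_apply T v).unique ?_
  convert hasSum_ite_eq (0 : ℕ) v using 2 with k
  rcases k with _ | k
  · simp
  · simp [pow_succ, h]

/-- Multiples of the identity commute with `T`. The shift turns a generator into an entrywise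
nonnegative operator, so that positivity can be read off the power series. -/
theorem exp_add_smul_one (T : E →L[ℝ] E) (c : ℝ) :
    operatorExp T = Real.exp (-c) • operatorExp (T + c • (1 : E →L[ℝ] E)) := by
  simp only [operatorExp]
  have h1 : NormedSpace.exp (((-c) • (1 : E →L[ℝ] E))) = Real.exp (-c) • (1 : E →L[ℝ] E) := by
    have := NormedSpace.algebraMap_exp_comm (𝕂 := ℝ) (𝔸 := E →L[ℝ] E) (-c)
    rw [Algebra.algebraMap_eq_smul_one, Algebra.algebraMap_eq_smul_one] at this
    rw [← this, Real.exp_eq_exp_ℝ]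
  have hT : T = (-c) • (1 : E →L[ℝ] E) + (T + c • (1 : E →L[ℝ] E)) := by
    rw [neg_smul]; abel
  have hcomm : Commute ((-c) • (1 : E →L[ℝ] E)) (T + c • (1 : E →L[ℝ] E)) :=
    (Commute.one_left _).smul_left _
  conv_lhs => rw [hT]
  rw [NormedSpace.exp_add_of_commute_of_mem_ball (𝕂 := ℝ) hcomm
    ((NormedSpace.expSeries_radius_eq_top ℝ (E →L[ℝ] E)).symm ▸ edist_lt_top _ _)
    ((NormedSpace.expSeries_radius_eq_top ℝ (E →L[ℝ] E)).symm ▸ edist_lt_top _ _), h1,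
    smul_mul_assoc, one_mul]

theorem exp_add_smul_apply (T : E →L[ℝ] E) (s t : ℝ) (v : E) :
    operatorExp ((s + t) • T) v = operatorExp (s • T) (operatorExp (t • T) v) := by
  simp only [operatorExp]
  rw [add_smul, NormedSpace.exp_add_of_commute_of_mem_ball (𝕂 := ℝ)
    (((Commute.refl T).smul_left s).smul_right t)
    ((NormedSpace.expSeries_radius_eq_top ℝ (E →L[ℝ] E)).symm ▸ edist_lt_top _ _)
    ((NormedSpace.expSeries_radius_eq_top ℝ (E →L[ℝ] E)).symm ▸ edist_lt_top _ _)]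
  rfl

theorem hasDerivAt_exp_smul_apply (T : E →L[ℝ] E) (v : E) (t : ℝ) :
    HasDerivAt (fun u : ℝ => operatorExp (u • T) v) (operatorExp (t • T) (T v)) t :=
  (ContinuousLinearMap.apply ℝ E v).hasFDerivAt.comp_hasDerivAt t
    (hasDerivAt_exp_smul_const T t)

/-- All terms of the series are nonnegative, so each is a lower bound for the sum. The term `k = 0`
yields preservation of positivity, larger `k` strict positivity. -/
theorem inv_factorial_smul_pow_apply_le_exp {ι : Type*} [Fintype ι]
    {B : (ι → ℝ) →L[ℝ] (ι → ℝ)} (hB : ∀ v, 0 ≤ v → 0 ≤ B v) {v : ι → ℝ} (hv : 0 ≤ v) (k : ℕ) :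
    ((k.factorial : ℝ)⁻¹) • (B ^ k) v ≤ operatorExp B v := by
  have hpow : ∀ j : ℕ, 0 ≤ (B ^ j) v := by
    intro j
    induction j with
    | zero => simpa using hv
    | succ j ih => rw [pow_succ']; exact hB _ ih
  exact le_hasSum (hasSum_exp_apply B v) k fun j _ => smul_nonneg (by positivity) (hpow j)

end Exponential

/-- Solutions of `y' = -c y + b(t)` with `c > 0` and `b(t) → b₀` converge to `b₀ / c`. -/
theorem tendsto_of_hasDerivAt_linear {E : Type*} [NormedAddCommGroup E] [NormedSpace ℝ E]
    {y b : ℝ → E} {c : ℝ} {b₀ : E} (hc : 0 < c)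
    (hy : ∀ t, HasDerivAt y (-(c • y t) + b t) t) (hb : Tendsto b atTop (𝓝 b₀)) :
    Tendsto y atTop (𝓝 (c⁻¹ • b₀)) := by
  rw [Metric.tendsto_atTop] at hb ⊢
  intro ε hε
  obtain ⟨T, hT⟩ := hb (c * (ε / 2)) (by positivity)
  -- Integrating factor: `w' = e^{ct} (b - b₀)`. After `T` its norm is at most `c (ε/2) e^{ct}`, the
  -- derivative of `(ε/2) e^{ct}`.
  set w : ℝ → E := fun t => Real.exp (c * t) • (y t - c⁻¹ • b₀) with hw
  have hexp : ∀ t, HasDerivAt (fun t => Real.exp (c * t)) (Real.exp (c * t) * c) t := fun t => by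
    simpa using ((hasDerivAt_id t).const_mul c).exp
  have hw' : ∀ t, HasDerivAt w (Real.exp (c * t) • (b t - b₀)) t := by
    intro t
    refine ((hexp t).smul ((hy t).sub_const (c⁻¹ • b₀))).congr_deriv ?_
    simp only [smul_add, smul_sub, smul_neg, smul_smul]
    rw [mul_assoc (Real.exp (c * t)) c c⁻¹, mul_inv_cancel₀ hc.ne', mul_one]
    abel
  have hbound : ∀ t, T ≤ t →
      ‖w t‖ ≤ ‖w T‖ + ε / 2 * (Real.exp (c * t) - Real.exp (c * T)) := by
    intro t ht
    refine image_norm_le_of_norm_deriv_right_le_deriv_boundary (a := T) (b := t)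
      (f' := fun t => Real.exp (c * t) • (b t - b₀))
      (B := fun t => ‖w T‖ + ε / 2 * (Real.exp (c * t) - Real.exp (c * T)))
      (B' := fun t => ε / 2 * (Real.exp (c * t) * c))
      (fun s _ => (hw' s).continuousAt.continuousWithinAt)
      (fun s _ => (hw' s).hasDerivWithinAt) (by simp)
      (fun s => (((hexp s).sub_const _).const_mul _).const_add _) ?_ ⟨ht, le_rfl⟩
    intro s hs
    rw [norm_smul, Real.norm_of_nonneg (Real.exp_pos _).le, ← dist_eq_norm]
    have := mul_le_mul_of_nonneg_left (hT s hs.1).le (Real.exp_pos (c * s)).le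
    linarith
  have hlim : Tendsto (fun t => Real.exp (-(c * t)) * ‖w T‖) atTop (𝓝 0) := by
    have h1 : Tendsto (fun t : ℝ => Real.exp (-(c * t))) atTop (𝓝 0) :=
      Real.tendsto_exp_neg_atTop_nhds_zero.comp (tendsto_id.const_mul_atTop hc)
    simpa using h1.mul_const ‖w T‖
  obtain ⟨T', hT'⟩ := eventually_atTop.1 (hlim.eventually (gt_mem_nhds (half_pos hε)))
  refine ⟨max T T', fun t ht => ?_⟩
  have h1 := hbound t ((le_max_left _ _).trans ht)
  have h2 := hT' t ((le_max_right _ _).trans ht)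
  have h3 : ‖w t‖ = Real.exp (c * t) * ‖y t - c⁻¹ • b₀‖ := by
    rw [hw]; simp [norm_smul]
  have h4 : ‖y t - c⁻¹ • b₀‖ = Real.exp (-(c * t)) * ‖w t‖ := by
    rw [h3, ← mul_assoc, ← Real.exp_add]; simp
  rw [dist_eq_norm, h4]
  have h5 : Real.exp (-(c * t)) * Real.exp (c * t) = 1 := by rw [← Real.exp_add]; simp
  have h6 := mul_le_mul_of_nonneg_left h1 (Real.exp_pos (-(c * t))).le
  have h7 : 0 < Real.exp (-(c * t)) * (ε / 2 * Real.exp (c * T)) := by positivity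
  have h8 : Real.exp (-(c * t)) * (‖w T‖ + ε / 2 * (Real.exp (c * t) - Real.exp (c * T)))
      = Real.exp (-(c * t)) * ‖w T‖ + ε / 2 * (Real.exp (-(c * t)) * Real.exp (c * t))
        - Real.exp (-(c * t)) * (ε / 2 * Real.exp (c * T)) := by ring
  rw [h8, h5] at h6
  linarith

/-! ### Convergence of the source chain -/

section SourceChain

variable {M : ℕ} {q : Matrix (Fin M) (Fin M) ℝ}

/-- The generator of the source chain as a bounded operator. -/
noncomputable def sourceGenerator (q : Matrix (Fin M) (Fin M) ℝ) :
    (Fin M → ℝ) →L[ℝ] (Fin M → ℝ) :=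
  LinearMap.toContinuousLinearMap q.mulVecLin

theorem sourceGenerator_apply (q : Matrix (Fin M) (Fin M) ℝ) (v : Fin M → ℝ) (i : Fin M) :
    sourceGenerator q v i = ∑ j, q i j * v j := rfl

/-- A shift that makes the generator of the source chain nonnegative. -/
noncomputable def sourceShift (q : Matrix (Fin M) (Fin M) ℝ) : ℝ := ∑ i, |q i i|

theorem mul_le_shifted_sourceGenerator (hq : IsIrreducibleGenerator q) {v : Fin M → ℝ}
    (hv : 0 ≤ v) {i j : Fin M} (hij : i ≠ j) :
    q i j * v j ≤ (sourceGenerator q + sourceShift q • 1) v i := by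
  have hc : 0 ≤ q i i + sourceShift q := by
    have := Finset.single_le_sum (f := fun i => |q i i|) (fun i _ => abs_nonneg _)
      (Finset.mem_univ i)
    have h2 := neg_abs_le (q i i)
    simp only [sourceShift]
    linarith
  have h1 : (sourceGenerator q + sourceShift q • 1) v i
      = (q i i + sourceShift q) * v i + ∑ j ∈ Finset.univ.erase i, q i j * v j := by
    simp only [add_apply, smul_apply, one_apply_eq_self, Pi.add_apply,
      Pi.smul_apply, smul_eq_mul, sourceGenerator_apply]
    rw [← Finset.add_sum_erase _ _ (Finset.mem_univ i)]
    ring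
  rw [h1]
  have h2 : q i j * v j ≤ ∑ j ∈ Finset.univ.erase i, q i j * v j :=
    Finset.single_le_sum (s := Finset.univ.erase i) (f := fun j => q i j * v j)
    (fun j hj => mul_nonneg (hq.nonneg i j (Finset.ne_of_mem_erase hj).symm) (hv j))
    (Finset.mem_erase.2 ⟨hij.symm, Finset.mem_univ j⟩)
  have h3 := mul_nonneg hc (hv i)
  linarith

theorem shifted_sourceGenerator_nonneg (hq : IsIrreducibleGenerator q) {v : Fin M → ℝ}
    (hv : 0 ≤ v) : 0 ≤ (sourceGenerator q + sourceShift q • 1) v := by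
  intro i
  by_cases h : ∃ j, i ≠ j
  · obtain ⟨j, hj⟩ := h
    exact (mul_nonneg (hq.nonneg i j hj) (hv j)).trans (mul_le_shifted_sourceGenerator hq hv hj)
  -- With a single state there is no off-diagonal entry, and the zero row sum forces the generator
  -- to vanish.
  · push Not at h
    have hrow := hq.row_sum i
    have huniv : (Finset.univ : Finset (Fin M)) = {i} := by
      ext j; simp [(h j).symm]
    rw [huniv, Finset.sum_singleton] at hrow
    simp only [add_apply, smul_apply, one_apply_eq_self, Pi.add_apply,
      Pi.smul_apply, smul_eq_mul, sourceGenerator_apply, huniv, Finset.sum_singleton, hrow,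
      zero_mul, zero_add, Pi.zero_apply]
    exact mul_nonneg (Finset.sum_nonneg fun _ _ => abs_nonneg _) (hv i)

theorem exp_sourceGenerator_nonneg (hq : IsIrreducibleGenerator q) {t : ℝ} (ht : 0 ≤ t)
    {v : Fin M → ℝ} (hv : 0 ≤ v) : 0 ≤ operatorExp (t • sourceGenerator q) v := by
  rw [exp_add_smul_one _ (t * sourceShift q), mul_smul, ← smul_add]
  refine smul_nonneg (Real.exp_pos _).le (le_trans ?_ (inv_factorial_smul_pow_apply_le_exp
    (fun v hv => smul_nonneg ht (shifted_sourceGenerator_nonneg hq hv)) hv 0))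
  simpa using hv

theorem exp_sourceGenerator_const (hq : IsIrreducibleGenerator q) (t c : ℝ) :
    operatorExp (t • sourceGenerator q) (fun _ => c) = fun _ => c := by
  refine exp_apply_of_apply_eq_zero ?_
  ext i
  simp [sourceGenerator_apply, ← Finset.sum_mul, hq.row_sum]

theorem exp_sourceGenerator_mono (hq : IsIrreducibleGenerator q) {t : ℝ} (ht : 0 ≤ t)
    {v w : Fin M → ℝ} (hvw : v ≤ w) :
    operatorExp (t • sourceGenerator q) v ≤ operatorExp (t • sourceGenerator q) w := by
  rw [← sub_nonneg, ← map_sub]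
  exact exp_sourceGenerator_nonneg hq ht (sub_nonneg.2 hvw)

/-- The exponent is the length of a path of positive rates from `i` to `j`; each edge contributes a
positive factor. -/
theorem exists_pow_shifted_sourceGenerator_pos (hq : IsIrreducibleGenerator q) (i j : Fin M) :
    ∃ k : ℕ, 0 < ((sourceGenerator q + sourceShift q • 1) ^ k) (Pi.single j 1) i := by
  have hpow : ∀ k : ℕ, 0 ≤ ((sourceGenerator q + sourceShift q • 1) ^ k) (Pi.single j 1) := by
    intro k
    induction k with
    | zero => simp
    | succ k ih => rw [pow_succ']; exact shifted_sourceGenerator_nonneg hq ih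
  induction hq.irreducible i j using Relation.ReflTransGen.head_induction_on with
  | refl => exact ⟨0, by simp⟩
  | head h _ ih =>
    obtain ⟨k, hk⟩ := ih
    refine ⟨k + 1, ?_⟩
    rw [pow_succ']
    exact (mul_pos h.2 hk).trans_le (mul_le_shifted_sourceGenerator hq (hpow k) h.1)

/-- Doeblin minorization at time 1: there are finitely many entries, so strict positivity is
uniform. -/
theorem exists_pos_le_exp_sourceGenerator (hq : IsIrreducibleGenerator q) :
    ∃ ε : ℝ, 0 < ε ∧ ∀ i j,
      ε ≤ operatorExp ((1 : ℝ) • sourceGenerator q) (Pi.single j 1) i := by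
  have hpos : ∀ i j, 0 < operatorExp ((1 : ℝ) • sourceGenerator q) (Pi.single j 1) i := by
    intro i j
    obtain ⟨k, hk⟩ := exists_pow_shifted_sourceGenerator_pos hq i j
    rw [one_smul, exp_add_smul_one _ (sourceShift q)]
    refine mul_pos (Real.exp_pos _) (lt_of_lt_of_le ?_
      (inv_factorial_smul_pow_apply_le_exp (fun v hv => shifted_sourceGenerator_nonneg hq hv)
        (by simp) k i))
    exact mul_pos (by positivity) hk
  rcases isEmpty_or_nonempty (Fin M) with h | h
  · exact ⟨1, one_pos, fun i => h.elim i⟩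
  · obtain ⟨p, hp⟩ := Finite.exists_min fun p : Fin M × Fin M =>
      operatorExp ((1 : ℝ) • sourceGenerator q) (Pi.single p.2 1) p.1
    exact ⟨_, hpos p.1 p.2, fun i j => hp (i, j)⟩

/-- The source chain converges to equilibrium. -/
theorem exists_tendsto_exp_sourceGenerator (hq : IsIrreducibleGenerator q) (m : Fin M) :
    ∃ p : ℝ, 0 ≤ p ∧ p ≤ 1 ∧
      Tendsto (fun t : ℝ => operatorExp (t • sourceGenerator q) (Pi.single m 1)) atTop
        (𝓝 fun _ => p) := by
  have : Nonempty (Fin M) := ⟨m⟩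
  obtain ⟨ε, hε, hlow⟩ := exists_pos_le_exp_sourceGenerator hq
  set u : ℝ → Fin M → ℝ := fun t => operatorExp (t • sourceGenerator q) (Pi.single m 1)
    with hu
  have hadd : ∀ s t, u (s + t) = operatorExp (s • sourceGenerator q) (u t) :=
    fun s t => exp_add_smul_apply _ s t _
  -- The extremes over the starting state: averaging makes `lo` increase and `hi` decrease, so both
  -- converge, and it remains to see that their limits agree.
  set lo : ℝ → ℝ := fun t => ⨅ i, u t i
  set hi : ℝ → ℝ := fun t => ⨆ i, u t i
  have hlo : ∀ t i, lo t ≤ u t i := fun t i => ciInf_le (Set.finite_range _).bddBelow i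
  have hhi : ∀ t i, u t i ≤ hi t := fun t i =>
    le_ciSup (f := u t) (Set.finite_range _).bddAbove i
  have hlohi : ∀ t, lo t ≤ hi t := fun t => (hlo t m).trans (hhi t m)
  have hstep : ∀ {s t : ℝ}, s ≤ t → ∀ i, lo s ≤ u t i ∧ u t i ≤ hi s := by
    intro s t hst i
    have h0 : u t = operatorExp ((t - s) • sourceGenerator q) (u s) := by
      rw [← hadd, sub_add_cancel]
    have h1 := exp_sourceGenerator_mono hq (sub_nonneg.2 hst) (fun i => hlo s i) i
    have h2 := exp_sourceGenerator_mono hq (sub_nonneg.2 hst) (fun i => hhi s i) i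
    rw [exp_sourceGenerator_const hq] at h1 h2
    rw [h0]
    exact ⟨h1, h2⟩
  have hmono : Monotone lo := fun s t hst => le_ciInf fun i => (hstep hst i).1
  have hanti : Antitone hi := fun s t hst => ciSup_le fun i => (hstep hst i).2
  have hle : ∀ s t, lo s ≤ hi t := fun s t =>
    (hmono (le_max_left s t)).trans ((hlohi _).trans (hanti (le_max_right s t)))
  have hl := tendsto_atTop_ciSup hmono ⟨hi 0, by rintro _ ⟨s, rfl⟩; exact hle s 0⟩
  have hh := tendsto_atTop_ciInf hanti ⟨lo 0, by rintro _ ⟨s, rfl⟩; exact hle 0 s⟩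
  set l := ⨆ t, lo t
  set h := ⨅ t, hi t
  have hlh : l ≤ h := le_of_tendsto_of_tendsto' hl hh hlohi
  -- From any state, the chain is after unit time at a maximizer `j` of `u t` with probability at
  -- least `ε`, which lifts the minimum by a fixed fraction of the gap. In the limit the gap must be
  -- zero.
  have hcontr : ∀ t, lo t + ε * (hi t - lo t) ≤ lo (1 + t) := by
    intro t
    refine le_ciInf fun i => ?_
    obtain ⟨j, hj⟩ := Finite.exists_max (u t)
    have hj' : hi t = u t j := le_antisymm (ciSup_le hj) (hhi t j)
    have h1 : (fun _ => lo t) + (hi t - lo t) • (Pi.single j 1 : Fin M → ℝ) ≤ u t := by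
      intro i
      rcases eq_or_ne i j with rfl | hij
      · simp [hj']
      · simpa [hij] using hlo t i
    have h2 := exp_sourceGenerator_mono hq zero_le_one h1 i
    rw [map_add, map_smul, exp_sourceGenerator_const hq, ← hadd] at h2
    have h3 := mul_le_mul_of_nonneg_left (hlow i j) (sub_nonneg.2 (hlohi t))
    simp only [Pi.add_apply, Pi.smul_apply, smul_eq_mul] at h2
    linarith
  have hlim : l + ε * (h - l) ≤ l :=
    le_of_tendsto_of_tendsto' (hl.add ((hh.sub hl).const_mul ε))
      (hl.comp (tendsto_atTop_add_const_left atTop 1 tendsto_id)) hcontr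
  have heq : h = l := le_antisymm (by nlinarith) hlh
  have h0 : u 0 = Pi.single m 1 := exp_apply_of_apply_eq_zero (by simp)
  refine ⟨l, ?_, ?_, ?_⟩
  · refine ge_of_tendsto hl ((eventually_ge_atTop 0).mono fun t ht => ?_)
    refine le_trans (le_ciInf fun i => ?_) (hmono ht)
    rw [h0]
    exact (by simp : (0 : Fin M → ℝ) ≤ Pi.single m 1) i
  · refine le_of_tendsto' hl fun t => (hle t 0).trans (ciSup_le fun i => ?_)
    rw [h0, Pi.single_apply]
    split_ifs <;> norm_num
  · rw [tendsto_pi_nhds]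
    intro i
    exact tendsto_of_tendsto_of_tendsto_of_le_of_le hl (heq ▸ hh) (fun t => hlo t i)
      fun t => hhi t i

end SourceChain

variable {n M : ℕ}

/-! ### The generator on indicators of fresh events -/

/-- A function of the source state, as a bounded function of the network state. -/
noncomputable def sourceFun (n M : ℕ) : (Fin M → ℝ) →L[ℝ] (State n M →ᵇ ℝ) :=
  LinearMap.mkContinuous
    { toFun := fun v => BoundedContinuousFunction.ofNormedAddCommGroupDiscrete
        (fun z => v z.source) ‖v‖ fun z => norm_le_pi_norm v z.source
      map_add' := fun _ _ => rfl
      map_smul' := fun _ _ => rfl } 1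
    fun v => by
      rw [one_mul]
      exact (BoundedContinuousFunction.norm_le (norm_nonneg v)).2
        fun z => norm_le_pi_norm v z.source

theorem sourceFun_apply (v : Fin M → ℝ) (z : State n M) : sourceFun n M v z = v z.source := rfl

/-- Pushes and gossip leave the source unchanged, so the source is autonomous; zero row sums absorb
the `-v i` terms. -/
theorem generator_sourceFun {q : Matrix (Fin M) (Fin M) ℝ} (hq : IsIrreducibleGenerator q)
    (lamS lam : ℝ) (v : Fin M → ℝ) :
    generator q lamS lam (sourceFun n M v) = sourceFun n M (sourceGenerator q v) := by
  ext z
  rw [generator_apply, sourceFun_apply, sourceGenerator_apply]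
  simp only [generatorFun, sourceFun_apply, State.jump, State.push, State.gossip, sub_self,
    mul_zero, Finset.sum_const_zero, add_zero]
  rw [Finset.sum_erase _ (by simp)]
  simp_rw [mul_sub]
  rw [Finset.sum_sub_distrib, ← Finset.sum_mul, hq.row_sum, zero_mul, sub_zero]

/-- The indicator of a fresh event. -/
noncomputable def freshFun (m : Fin M) (A : Finset (Fin n)) (hA : A.Nonempty) :
    State n M →ᵇ ℝ :=
  BoundedContinuousFunction.indicator (freshEvent m A hA) (isClopen_discrete _)

theorem mem_freshEvent {m : Fin M} {A : Finset (Fin n)} {hA : A.Nonempty} {z : State n M} :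
    z ∈ freshEvent m A hA ↔ z.source = m ∧ ∃ j ∈ A, z.age j = 0 := by
  have h : z.setAge A hA = 0 ↔ ∃ j ∈ A, z.age j = 0 := by
    rw [State.setAge, ← Nat.le_zero, Finset.inf'_le_iff]
    simp
  exact and_congr_right fun _ => h

open Classical in
theorem freshFun_apply (m : Fin M) (A : Finset (Fin n)) (hA : A.Nonempty) (z : State n M) :
    freshFun m A hA z = if z.source = m ∧ ∃ j ∈ A, z.age j = 0 then 1 else 0 := by
  simp only [freshFun, BoundedContinuousFunction.indicator_apply, Set.indicator_apply,
    mem_freshEvent, Pi.one_apply]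

theorem freshFun_jump (m : Fin M) (A : Finset (Fin n)) (hA : A.Nonempty) (z : State n M)
    (r : Fin M) : freshFun m A hA (z.jump r) = 0 := by
  classical
  rw [freshFun_apply, if_neg]
  simp [State.jump]

theorem freshFun_push (m : Fin M) (A : Finset (Fin n)) (hA : A.Nonempty) (z : State n M)
    (j : Fin n) : freshFun m A hA (z.push j) =
      if j ∈ A then sourceFun n M (Pi.single m 1) z else freshFun m A hA z := by
  classical
  rw [sourceFun_apply, Pi.single_apply]
  split_ifs with hj hm
  · rw [freshFun_apply, if_pos ⟨hm, j, hj, by simp [State.push]⟩]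
  · rw [freshFun_apply, if_neg fun h => hm h.1]
  · simp only [freshFun_apply, State.push]
    congr 2
    refine propext (exists_congr fun l => and_congr_right fun hl => ?_)
    rw [Function.update_of_ne (ne_of_mem_of_not_mem hl hj)]

/-- The receiver's new age is the minimum of the two, so it is zero exactly when one of the two was.
Senders already in `A` are included: inserting them changes nothing. -/
theorem freshFun_gossip (m : Fin M) (A : Finset (Fin n)) (hA : A.Nonempty) (z : State n M)
    (i j : Fin n) : freshFun m A hA (z.gossip i j) =
      if j ∈ A then freshFun m (insert i A) (A.insert_nonempty i) z else freshFun m A hA z := by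
  classical
  split_ifs with hj
  · simp only [freshFun_apply, State.gossip]
    congr 2
    refine propext ⟨?_, ?_⟩
    · rintro ⟨l, hl, h⟩
      rcases eq_or_ne l j with rfl | hlj
      · rw [Function.update_self] at h
        rcases min_choice (z.age i) (z.age l) with h' | h' <;> rw [h'] at h
        · exact ⟨i, Finset.mem_insert_self _ _, h⟩
        · exact ⟨l, Finset.mem_insert_of_mem hl, h⟩
      · rw [Function.update_of_ne hlj] at h
        exact ⟨l, Finset.mem_insert_of_mem hl, h⟩
    · rintro ⟨l, hl, h⟩
      rcases Finset.mem_insert.1 hl with rfl | hl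
      · exact ⟨j, hj, by simp [h]⟩
      · rcases eq_or_ne l j with rfl | hlj
        · exact ⟨l, hl, by simp [h]⟩
        · exact ⟨l, hl, by rwa [Function.update_of_ne hlj]⟩
  · simp only [freshFun_apply, State.gossip]
    congr 2
    refine propext (exists_congr fun l => and_congr_right fun hl => ?_)
    rw [Function.update_of_ne (ne_of_mem_of_not_mem hl hj)]

theorem freshFun_insert_of_mem (m : Fin M) {A : Finset (Fin n)} (hA : A.Nonempty) {i : Fin n}
    (hi : i ∈ A) : freshFun m (insert i A) (A.insert_nonempty i) = freshFun m A hA := by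
  congr 1
  exact Finset.insert_eq_of_mem hi

/-- Each of the `k` receivers in `A` contributes the same sum over senders outside `A`, senders
inside giving zero. The `n - k` subtracted copies of the indicator make up the decay rate `β_k`. -/
theorem generator_freshFun (q : Matrix (Fin M) (Fin M) ℝ) (lamS lam : ℝ) (m : Fin M)
    (A : Finset (Fin n)) (hA : A.Nonempty) :
    generator q lamS lam (freshFun m A hA) =
      -((exitRate q m + pushRate n lamS A.card + gossipRate n lam A.card) • freshFun m A hA)
      + (pushRate n lamS A.card • sourceFun n M (Pi.single m 1)
        + (A.card * lam / ((n : ℝ) - 1)) •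
          ∑ i ∈ Aᶜ, freshFun m (insert i A) (A.insert_nonempty i)) := by
  classical
  ext z
  have hjump : ∑ r ∈ Finset.univ.erase z.source,
      q z.source r * (freshFun m A hA (z.jump r) - freshFun m A hA z)
      = -(exitRate q m * freshFun m A hA z) := by
    simp_rw [freshFun_jump, zero_sub]
    rw [← Finset.sum_mul, mul_neg]
    by_cases hm : z.source = m
    · rw [exitRate, hm]
    · rw [freshFun_apply, if_neg fun h => hm h.1]; simp
  have hpush : ∑ j : Fin n, lamS / n * (freshFun m A hA (z.push j) - freshFun m A hA z)
      = pushRate n lamS A.card * (sourceFun n M (Pi.single m 1) z - freshFun m A hA z) := by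
    have h : ∀ j : Fin n, lamS / n * (freshFun m A hA (z.push j) - freshFun m A hA z)
        = if j ∈ A then
          lamS / n * (sourceFun n M (Pi.single m 1) z - freshFun m A hA z) else 0 := by
      intro j
      rw [freshFun_push]
      split_ifs <;> simp
    simp_rw [h]
    rw [Finset.sum_ite_mem, Finset.univ_inter, Finset.sum_const, nsmul_eq_mul, pushRate]
    ring
  have hgossip : ∑ j : Fin n, ∑ i ∈ Finset.univ.erase j,
      lam / ((n : ℝ) - 1) * (freshFun m A hA (z.gossip i j) - freshFun m A hA z)
      = A.card * lam / ((n : ℝ) - 1) *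
        ∑ i ∈ Aᶜ, (freshFun m (insert i A) (A.insert_nonempty i) z - freshFun m A hA z) := by
    have h : ∀ j : Fin n, ∑ i ∈ Finset.univ.erase j,
        lam / ((n : ℝ) - 1) * (freshFun m A hA (z.gossip i j) - freshFun m A hA z)
        = if j ∈ A then lam / ((n : ℝ) - 1) *
          ∑ i ∈ Aᶜ, (freshFun m (insert i A) (A.insert_nonempty i) z - freshFun m A hA z)
          else 0 := by
      intro j
      split_ifs with hj
      · simp_rw [freshFun_gossip, if_pos hj]
        rw [← Finset.mul_sum]
        congr 1
        refine (Finset.sum_subset (fun i hi => ?_) fun i _ hi => ?_).symm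
        · refine Finset.mem_erase.2 ⟨?_, Finset.mem_univ i⟩
          rintro rfl
          exact Finset.mem_compl.1 hi hj
        · rw [Finset.mem_compl, not_not] at hi
          rw [freshFun_insert_of_mem m hA hi, sub_self]
      · simp_rw [freshFun_gossip, if_neg hj]
        simp
    simp_rw [h]
    rw [Finset.sum_ite_mem, Finset.univ_inter, Finset.sum_const, nsmul_eq_mul]
    ring
  have hcard : (Aᶜ.card : ℝ) = n - A.card := by
    rw [Finset.card_compl, Fintype.card_fin,
      Nat.cast_sub (by simpa using Finset.card_le_univ A)]
  have hsum : (∑ i ∈ Aᶜ, freshFun m (insert i A) (A.insert_nonempty i)) z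
      = ∑ i ∈ Aᶜ, freshFun m (insert i A) (A.insert_nonempty i) z := by
    simp
  rw [generator_apply, generatorFun, hjump, hpush, hgossip, Finset.sum_sub_distrib,
    Finset.sum_const, nsmul_eq_mul, hcard]
  simp only [BoundedContinuousFunction.coe_add, BoundedContinuousFunction.coe_neg,
    BoundedContinuousFunction.coe_smul, Pi.add_apply, Pi.neg_apply, smul_eq_mul, hsum, gossipRate]
  ring

/-! ### Long-run limits -/

/-- The solution of the recursion
`g_k = (α_k p + β_k g_{k+1}) / (ν_m + α_k + β_k)`, `k = n, n - 1, …`,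
indexed by `d = n + 1 - k`. -/
noncomputable def freshRec (n : ℕ) (q : Matrix (Fin M) (Fin M) ℝ) (lamS lam : ℝ) (m : Fin M)
    (p : ℝ) : ℕ → ℝ
  -- A dummy value for `g_{n+1}`; it only ever enters multiplied by `β_n = 0`.
  | 0 => 0
  | d + 1 => (exitRate q m + pushRate n lamS (n - d : ℕ) + gossipRate n lam (n - d : ℕ))⁻¹ *
      (pushRate n lamS (n - d : ℕ) * p +
        gossipRate n lam (n - d : ℕ) * freshRec n q lamS lam m p d)

/-- The long-run probability that the source is in the state `m` and a set of `k` nodes is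
fresh, where `p` is the equilibrium probability of `m`. -/
noncomputable def freshLimit (n : ℕ) (q : Matrix (Fin M) (Fin M) ℝ) (lamS lam : ℝ) (m : Fin M)
    (p : ℝ) (k : ℕ) : ℝ := freshRec n q lamS lam m p (n + 1 - k)

theorem freshLimit_eq (q : Matrix (Fin M) (Fin M) ℝ) (lamS lam : ℝ) (m : Fin M)
    (p : ℝ) {k : ℕ} (hk : k ≤ n) : freshLimit n q lamS lam m p k =
      (exitRate q m + pushRate n lamS k + gossipRate n lam k)⁻¹ *
        (pushRate n lamS k * p + gossipRate n lam k * freshLimit n q lamS lam m p (k + 1)) := by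
  have h1 : n + 1 - k = (n - k) + 1 := by omega
  have h2 : n - (n - k) = k := by omega
  have h3 : n + 1 - (k + 1) = n - k := by omega
  rw [freshLimit, freshLimit, h1, h3, freshRec, h2]

theorem exitRate_nonneg {q : Matrix (Fin M) (Fin M) ℝ} (hq : IsIrreducibleGenerator q)
    (m : Fin M) : 0 ≤ exitRate q m :=
  Finset.sum_nonneg fun r hr => hq.nonneg m r (Finset.ne_of_mem_erase hr).symm

theorem pushRate_pos {lamS : ℝ} (hlamS : 0 < lamS) {k : ℕ} (hk : 1 ≤ k) (hkn : k ≤ n) :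
    0 < pushRate n lamS k := by
  have h1 : (0 : ℝ) < k := by exact_mod_cast hk
  have h2 : (0 : ℝ) < n := by exact_mod_cast hk.trans hkn
  unfold pushRate
  positivity

theorem gossipRate_nonneg {lam : ℝ} (hlam : 0 ≤ lam) {k : ℕ} (hk : 1 ≤ k) (hkn : k ≤ n) :
    0 ≤ gossipRate n lam k := by
  have h1 : (k : ℝ) ≤ n := by exact_mod_cast hkn
  have h2 : (1 : ℝ) ≤ n := by exact_mod_cast hk.trans hkn
  exact div_nonneg (mul_nonneg (mul_nonneg k.cast_nonneg (sub_nonneg.2 h1)) hlam)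
    (sub_nonneg.2 h2)

theorem gossipRate_self (lam : ℝ) : gossipRate n lam n = 0 := by simp [gossipRate]

/-- By the recursion `g_k` combines `p` and `g_{k+1}` with nonnegative weights of sum at most 1. The
downward induction starts at the dummy value for `k = n + 1`. -/
theorem freshLimit_mem {q : Matrix (Fin M) (Fin M) ℝ} (hq : IsIrreducibleGenerator q)
    {lamS lam : ℝ} (hlamS : 0 < lamS) (hlam : 0 ≤ lam) (m : Fin M) {p : ℝ} (hp : 0 ≤ p)
    (hp1 : p ≤ 1) {k : ℕ} (hk : 1 ≤ k) (hkn : k ≤ n + 1) :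
    0 ≤ freshLimit n q lamS lam m p k ∧ freshLimit n q lamS lam m p k ≤ 1 := by
  induction hkn using Nat.decreasingInduction with
  | self => simp [freshLimit, freshRec]
  | of_succ k hkn ih =>
    obtain ⟨h0, h1⟩ := ih (by omega)
    have hkn : k ≤ n := by omega
    have hν := exitRate_nonneg hq m
    have hα := pushRate_pos hlamS hk hkn
    have hβ := gossipRate_nonneg hlam hk hkn
    rw [freshLimit_eq q lamS lam m p hkn]
    refine ⟨by positivity, ?_⟩
    rw [inv_mul_le_iff₀ (by positivity)]
    nlinarith [mul_le_mul_of_nonneg_left h1 hβ, mul_le_mul_of_nonneg_left hp1 hα.le]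

theorem freshLimit_sub {q : Matrix (Fin M) (Fin M) ℝ} (hq : IsIrreducibleGenerator q)
    {lamS lam : ℝ} (hlamS : 0 < lamS) (hlam : 0 ≤ lam) (m : Fin M) {p : ℝ} (hp : 0 ≤ p)
    (hp1 : p ≤ 1) {k : ℕ} (hk : 1 ≤ k) (hkn : k ≤ n) :
    |freshLimit n q lamS lam m p k - freshLimit n q lamS lam m p (k + 1)| ≤
      (pushRate n lamS k + exitRate q m) /
        (exitRate q m + pushRate n lamS k + gossipRate n lam k) := by
  have hν := exitRate_nonneg hq m
  have hα := pushRate_pos hlamS hk hkn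
  have hβ := gossipRate_nonneg hlam hk hkn
  obtain ⟨h0, h1⟩ := freshLimit_mem (n := n) hq hlamS hlam m hp hp1 (k := k + 1) (by omega) (by omega)
  have hD : 0 < exitRate q m + pushRate n lamS k + gossipRate n lam k := by positivity
  -- The gossip terms cancel in the numerator `α_k p - (α_k + ν_m) g_{k+1}`, which lies between
  -- `-(α_k + ν_m)` and `α_k`.
  have heq : freshLimit n q lamS lam m p k - freshLimit n q lamS lam m p (k + 1)
      = (pushRate n lamS k * p - (pushRate n lamS k + exitRate q m) *
          freshLimit n q lamS lam m p (k + 1)) /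
        (exitRate q m + pushRate n lamS k + gossipRate n lam k) := by
    rw [freshLimit_eq q lamS lam m p hkn]
    field_simp
    ring
  rw [heq, abs_div, abs_of_pos hD]
  refine div_le_div_of_nonneg_right (abs_le.2 ⟨?_, ?_⟩) hD.le
  · have := mul_le_mul_of_nonneg_left h1 (add_nonneg hα.le hν)
    have := mul_nonneg hα.le hp
    linarith
  · have := mul_nonneg (add_nonneg hα.le hν) h0
    have := mul_le_mul_of_nonneg_left hp1 hα.le
    linarith

theorem tendsto_gossipRate {k : ℕ} (hk : 1 ≤ k) (hkn : k < n) :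
    Tendsto (fun lam => gossipRate n lam k) atTop atTop := by
  have h0 : (1 : ℝ) ≤ k := by exact_mod_cast hk
  have h1 : (k : ℝ) < n := by exact_mod_cast hkn
  have h2 : 0 < (k : ℝ) * (n - k) / (n - 1) :=
    div_pos (mul_pos (by linarith) (by linarith)) (by linarith)
  refine (tendsto_id.const_mul_atTop h2).congr fun lam => ?_
  simp only [gossipRate, id]
  ring

theorem tendsto_freshLimit_sub {q : Matrix (Fin M) (Fin M) ℝ} (hq : IsIrreducibleGenerator q)
    {lamS : ℝ} (hlamS : 0 < lamS) (m : Fin M) {p : ℝ} (hp : 0 ≤ p)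
    (hp1 : p ≤ 1) {k : ℕ} (hk : 1 ≤ k) (hkn : k < n) :
    Tendsto (fun lam => freshLimit n q lamS lam m p k - freshLimit n q lamS lam m p (k + 1))
      atTop (𝓝 0) := by
  refine squeeze_zero_norm' ((eventually_ge_atTop 0).mono fun lam hlam =>
    freshLimit_sub hq hlamS hlam m hp hp1 hk hkn.le) ?_
  exact tendsto_const_nhds.div_atTop (tendsto_atTop_add_const_left _ _ (tendsto_gossipRate hk hkn))

/-- At `k = n` no gossip comes from outside, so the value is constant in `lam`; vanishing
differences carry it down to smaller `k`. -/
theorem tendsto_freshLimit {q : Matrix (Fin M) (Fin M) ℝ} (hq : IsIrreducibleGenerator q)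
    {lamS : ℝ} (hlamS : 0 < lamS) (m : Fin M) {p : ℝ} (hp : 0 ≤ p)
    (hp1 : p ≤ 1) {k : ℕ} (hk : 1 ≤ k) (hkn : k ≤ n) :
    Tendsto (fun lam => freshLimit n q lamS lam m p k) atTop
      (𝓝 ((exitRate q m + pushRate n lamS n)⁻¹ * (pushRate n lamS n * p))) := by
  induction hkn using Nat.decreasingInduction with
  | self =>
    refine tendsto_const_nhds.congr fun lam => ?_
    rw [freshLimit_eq q lamS lam m p le_rfl, gossipRate_self]
    simp
  | of_succ k hkn ih =>
    simpa using (tendsto_freshLimit_sub hq hlamS m hp hp1 hk hkn).add (ih (by omega))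

/-! ### Convergence of the semigroup and of the process -/

theorem tendsto_exp_generator_freshFun {q : Matrix (Fin M) (Fin M) ℝ}
    (hq : IsIrreducibleGenerator q) {lamS lam : ℝ} (hlamS : 0 < lamS) (hlam : 0 ≤ lam)
    {m : Fin M} {p : ℝ}
    (hp : Tendsto (fun t : ℝ => operatorExp (t • sourceGenerator q) (Pi.single m 1)) atTop
        (𝓝 fun _ => p))
    (A : Finset (Fin n)) (hA : A.Nonempty) :
    Tendsto (fun t : ℝ => operatorExp (t • generator q lamS lam) (freshFun m A hA)) atTop
      (𝓝 (BoundedContinuousFunction.const _ (freshLimit n q lamS lam m p A.card))) := by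
  obtain ⟨d, hd⟩ : ∃ d, A.card + d = n + 1 :=
    Nat.exists_eq_add_of_le (by simpa using (Finset.card_le_univ A).trans (Nat.le_succ _)) |>.imp
      fun _ h => h.symm
  -- Induction on `d = n + 1 - |A|`; the case `d = 0` is void because `A` has at most `n` elements.
  induction d generalizing A with
  | zero =>
    have := Finset.card_le_univ A
    rw [Fintype.card_fin] at this
    omega
  | succ d ih =>
    have hk : 1 ≤ A.card := hA.card_pos
    have hkn : A.card ≤ n := by omega
    have hc : 0 < exitRate q m + pushRate n lamS A.card + gossipRate n lam A.card := by
      have := exitRate_nonneg hq m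
      have := pushRate_pos hlamS hk hkn
      have := gossipRate_nonneg hlam hk hkn
      positivity
    have hsource : Tendsto (fun t : ℝ => operatorExp (t • generator q lamS lam)
        (sourceFun n M (Pi.single m 1))) atTop (𝓝 (sourceFun n M fun _ => p)) := by
      refine (((sourceFun n M).continuous.tendsto _).comp hp).congr fun t => ?_
      refine (exp_intertwine (fun v => ?_) _).symm
      simp [generator_sourceFun hq]
    have hinsert := tendsto_finsetSum Aᶜ fun i (hi : i ∈ Aᶜ) => ih (insert i A)
      (A.insert_nonempty i) (by rw [Finset.card_insert_of_notMem (Finset.mem_compl.1 hi)]; omega)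
    -- Backward equation: the derivative is the semigroup applied to the generator's value, and
    -- `generator_freshFun` splits that into decay and a forcing known to converge.
    have hlim := tendsto_of_hasDerivAt_linear (c := _) hc
      (y := fun t : ℝ => operatorExp (t • generator q lamS lam) (freshFun m A hA))
      (fun t => by
        refine (hasDerivAt_exp_smul_apply (generator q lamS lam) (freshFun m A hA) t).congr_deriv
          ?_
        rw [generator_freshFun, map_add, map_neg, map_smul, map_add, map_smul, map_smul, map_sum])
      ((hsource.const_smul (pushRate n lamS A.card)).add
        (hinsert.const_smul (A.card * lam / ((n : ℝ) - 1))))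
    -- The limit of the linear equation is the recursion for `g_k`: the `n - k` equal summands turn
    -- `kλ/(n-1)` into `β_k`.
    convert hlim using 2
    ext z
    have hcard : (Aᶜ.card : ℝ) = n - A.card := by
      rw [Finset.card_compl, Fintype.card_fin, Nat.cast_sub hkn]
    have hsum : (∑ i ∈ Aᶜ, BoundedContinuousFunction.const (State n M)
        (freshLimit n q lamS lam m p (insert i A).card)) z
        = (n - A.card) * freshLimit n q lamS lam m p (A.card + 1) := by
      rw [BoundedContinuousFunction.coe_sum, Finset.sum_apply, ← hcard, ← nsmul_eq_mul,
        ← Finset.sum_const]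
      refine Finset.sum_congr rfl fun i hi => ?_
      rw [BoundedContinuousFunction.const_apply,
        Finset.card_insert_of_notMem (Finset.mem_compl.1 hi)]
    simp only [BoundedContinuousFunction.const_apply, BoundedContinuousFunction.coe_smul,
      BoundedContinuousFunction.coe_add, Pi.add_apply, smul_eq_mul, hsum, sourceFun_apply]
    rw [freshLimit_eq q lamS lam m p hkn, gossipRate]
    ring

/-- The Markov property at time 0, integrated over the initial law. -/
theorem IsNetworkProcess.measureReal_eq_integral {q : Matrix (Fin M) (Fin M) ℝ}
    {lamS lam : ℝ} {Ω : Type*} [MeasurableSpace Ω] {P : Measure Ω} [IsProbabilityMeasure P]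
    {Z : ℝ≥0 → Ω → State n M} (hZ : IsNetworkProcess q lamS lam P Z) (t : ℝ≥0)
    (B : Set (State n M)) :
    P.real {ω | Z t ω ∈ B} = ∫ ω, transProb q lamS lam t (Z 0 ω) B ∂P := by
  have hm : ⨆ u ∈ Set.Iic (0 : ℝ≥0), MeasurableSpace.comap (Z u) ⊤ ≤ ‹MeasurableSpace Ω› :=
    iSup₂_le fun u _ => (hZ.measurable u).comap_le
  have h := hZ.markov 0 t (BoundedContinuousFunction.indicator B (isClopen_discrete B))
  rw [zero_add] at h
  have hB : MeasurableSet {ω | Z t ω ∈ B} := hZ.measurable t (by trivial)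
  unfold transProb
  rw [← integral_congr_ae h, integral_condExp hm, ← integral_indicator_one hB]
  rfl

/-- Averaging over the initial law does not increase the sup-norm distance to the constant `c`. -/
theorem IsNetworkProcess.tendsto_measureReal {q : Matrix (Fin M) (Fin M) ℝ}
    {lamS lam : ℝ} {Ω : Type*} [MeasurableSpace Ω] {P : Measure Ω} [IsProbabilityMeasure P]
    {Z : ℝ≥0 → Ω → State n M} (hZ : IsNetworkProcess q lamS lam P Z) {B : Set (State n M)}
    {c : ℝ} (h : Tendsto (fun t : ℝ≥0 => semigroup q lamS lam t
      (BoundedContinuousFunction.indicator B (isClopen_discrete B))) atTop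
        (𝓝 (BoundedContinuousFunction.const _ c))) :
    Tendsto (fun t : ℝ≥0 => P.real {ω | Z t ω ∈ B}) atTop (𝓝 c) := by
  rw [tendsto_iff_norm_sub_tendsto_zero] at h ⊢
  refine squeeze_zero (fun _ => norm_nonneg _) (fun t => ?_) h
  set f := semigroup q lamS lam t
    (BoundedContinuousFunction.indicator B (isClopen_discrete B)) with hf
  have hint : Integrable (fun ω => f (Z 0 ω)) P := by
    refine Integrable.of_bound (C := ‖f‖) ?_ (.of_forall fun ω => f.norm_coe_le_norm _)
    exact ((measurable_from_top (f := f)).comp (hZ.measurable 0)).aestronglyMeasurable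
  have hsub : P.real {ω | Z t ω ∈ B} - c
      = ∫ ω, (f - BoundedContinuousFunction.const (State n M) c) (Z 0 ω) ∂P := by
    rw [hZ.measureReal_eq_integral]
    simp only [BoundedContinuousFunction.coe_sub, Pi.sub_apply,
      BoundedContinuousFunction.const_apply]
    rw [integral_sub hint (integrable_const c), integral_const]
    simp [transProb, hf]
  rw [hsub]
  refine (norm_integral_le_of_norm_le_const (.of_forall fun ω =>
    BoundedContinuousFunction.norm_coe_le_norm _ (Z 0 ω))).trans ?_
  simp

end GossipNetwork

open GossipNetwork in
theorem mainTheorem11 {n M : ℕ} (hn : 2 ≤ n) (q : Matrix (Fin M) (Fin M) ℝ)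
    (hq : IsIrreducibleGenerator q) (lamS : ℝ) (hlamS : 0 < lamS) :
    ∃ g : ℝ → ℕ → Fin M → ℝ,
      -- `g lam k m` is the long-run probability that `Q = m` and `X_A = 0`, for every set `A`
      -- of `k` nodes and from every initial state or initial distribution
      (∀ lam : ℝ, 0 ≤ lam → ∀ (m : Fin M) (A : Finset (Fin n)) (hA : A.Nonempty),
        (∀ z : State n M,
          Tendsto (fun t : ℝ≥0 => transProb q lamS lam t z (freshEvent m A hA)) atTop
            (𝓝 (g lam A.card m))) ∧
        (∀ (Ω : Type*) [MeasurableSpace Ω] (P : Measure Ω) [IsProbabilityMeasure P]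
          (Z : ℝ≥0 → Ω → State n M), IsNetworkProcess q lamS lam P Z →
          Tendsto (fun t : ℝ≥0 => P.real {ω | Z t ω ∈ freshEvent m A hA}) atTop
            (𝓝 (g lam A.card m)))) ∧
      -- the explicit bound
      (∀ lam : ℝ, 0 ≤ lam → ∀ (m : Fin M) (k : ℕ), 1 ≤ k → k ≤ n - 1 →
        |g lam k m - g lam (k + 1) m| ≤
          (pushRate n lamS k + exitRate q m) /
            (exitRate q m + pushRate n lamS k + gossipRate n lam k)) ∧
      -- consecutive differences vanish as the gossip rate grows
      (∀ (m : Fin M) (k : ℕ), 1 ≤ k → k ≤ n - 1 →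
        Tendsto (fun lam : ℝ => g lam k m - g lam (k + 1) m) atTop (𝓝 0)) ∧
      -- all of them have the same limit
      (∀ m : Fin M, ∃ l : ℝ, ∀ k : ℕ, 1 ≤ k → k ≤ n →
        Tendsto (fun lam : ℝ => g lam k m) atTop (𝓝 l)) := by
  choose p hp0 hp1 hp using exists_tendsto_exp_sourceGenerator hq
  refine ⟨fun lam k m => freshLimit n q lamS lam m (p m) k, fun lam hlam m A hA => ?_,
    fun lam hlam m k hk hkn => freshLimit_sub hq hlamS hlam m (hp0 m) (hp1 m) hk (by omega),
    fun m k hk hkn => tendsto_freshLimit_sub hq hlamS m (hp0 m) (hp1 m) hk (by omega),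
    fun m => ⟨_, fun k hk hkn => tendsto_freshLimit hq hlamS m (hp0 m) (hp1 m) hk hkn⟩⟩
  have hlim := (tendsto_exp_generator_freshFun hq hlamS hlam (hp m) A hA).comp
    (NNReal.tendsto_coe_atTop.2 tendsto_id)
  refine ⟨fun z => ?_, fun Ω _ P _ Z hZ => hZ.tendsto_measureReal hlim⟩
  exact ((BoundedContinuousFunction.evalCLM ℝ z).continuous.tendsto _).comp hlim
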